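/- Let $M$ be a complex manifold (of finite dimension) and let $L=T^{1,0}\oplus T^{*(0,1)}\subset (T\oplus T^*)_{\mathbb C}$, $\overline L=T^{0,1}\oplus T^{*(1,0)}$. The sections of $L$ and those of $\overline L$ are closed under the Courant bracket $$[\![X+\alpha,Y+\beta]\!]=[X,Y]+\mathcal L_X\beta-\mathcal L_Y\alpha-\tfrac12 d(\iota_X\beta-\iota_Y\alpha).$$ Denote by $[\![-,-]\!]$ also the Schouten bracket on $C^\infty(M,\wedge^\bullet L)$, i.e. the extension of the bracket of $L$ as a graded biderivation of the exterior product with $[\![X+\alpha,f]\!]=Xf$ and $[\![f,g]\!]=0$ for functions $f,g$. Let $\overline\partial:C^\infty(M,\wedge^kL)\to C^\infty(M,\wedge^{k+1}L)$ be the Lie algebroid differential of $\overline L$, where $\overline L$ is identified with $L^*$ through the pairing $(X+\alpha,Y+\beta)\mapsto\alpha(Y)+\beta(X)$. A section $\phi$ of $L^*\otimes L=\mathrm{End}(L)$ acts on $\wedge^\bullet L$ as the derivation of degree $0$ that extends it and vanishes on functions. A pair of smooth sections $\Gamma_1\in C^\infty(M,\wedge^2L)$ and $\phi\in C^\infty(M,L^*\otimes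 L)$ is called compatible if $\overline\partial\Gamma_1=0$ and, for all $A,B\in C^\infty(M,\wedge^\bullet L)$, $$\overline\partial(\phi A)-\phi(\overline\partial A)=[\![\Gamma_1,A]\!],\qquad [\![\phi A,B]\!]+[\![A,\phi B]\!]=\phi[\![A,B]\!],\qquad \phi(A\wedge B)=(\phi A)\wedge B+A\wedge(\phi B).$$ Proposition. Let $\Gamma_1\in C^\infty(M,\wedge^2L)$ and $\phi\in C^\infty(M,L^*\otimes L)$. Write $\Gamma_1=\Lambda+\widehat\Gamma_1+\Omega$ with $\Lambda$, $\widehat\Gamma_1$, $\Omega$ the components of $\Gamma_1$ in $\wedge^2T^{1,0}$, $T^{1,0}\otimes T^{*(0,1)}$, $\wedge^2T^{*(0,1)}$, and write $\phi=\phi_1+\phi_2+\phi_3+\phi_4$ with $\phi_1,\phi_2,\phi_3,\phi_4$ the blocks of $\phi$ in $\mathrm{End}(T^{1,0},T^{1,0})$, $\mathrm{End}(T^{*(0,1)},T^{*(0,1)})$, $\mathrm{End}(T^{1,0},T^{*(0,1)})$, $\mathrm{End}(T^{*(0,1)},T^{1,0})$, where $\mathrm{End}(V,W)$ denotes the bundle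 maps from $V$ to $W$. Then the pair $(\Gamma_1,\phi)$ is compatible if and only if the three pairs $(\Lambda,\phi_4)$, $(\Omega,\phi_3)$ and $(\widehat\Gamma_1,\phi_1+\phi_2)$ are all compatible. -/

import Mathlib

open scoped Manifold ContDiff

noncomputable section

namespace ComplexDGA

section Fibre

variable (E : Type*) [NormedAddCommGroup E] [NormedSpace ℂ E]

/-- The fibre of the bundle `L = T^{1,0} ⊕ T^{*(0,1)}` of a complex manifold modelled on `E`.
Mathlib identifies the tangent space at a point `x` with `E` through the preferred chart at `x`, and
the complex structure is multiplication by `Complex.I` on `E`. A vector `v : E` stands for the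
`(1,0)`-vector `(v - i J v) / 2`. A `(0,1)`-covector is a complex valued covector that is
conjugate-linear for the complex structure. -/
abbrev LFibre : Type _ := E × (E →L⋆[ℂ] ℂ)

/-- The exterior algebra `∧^• L_x` of the fibre. -/
abbrev ExtL : Type _ := ExteriorAlgebra ℂ (LFibre E)

variable {E}

/-- The projection of `L` onto `T^{1,0}` along `T^{*(0,1)}`. -/
def projT : LFibre E →L[ℂ] LFibre E :=
  (ContinuousLinearMap.inl ℂ E (E →L⋆[ℂ] ℂ)).comp (ContinuousLinearMap.fst ℂ E (E →L⋆[ℂ] ℂ))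

/-- The projection of `L` onto `T^{*(0,1)}` along `T^{1,0}`. -/
def projTstar : LFibre E →L[ℂ] LFibre E :=
  (ContinuousLinearMap.inr ℂ E (E →L⋆[ℂ] ℂ)).comp (ContinuousLinearMap.snd ℂ E (E →L⋆[ℂ] ℂ))

variable [FiniteDimensional ℂ E]

instance finiteDimensional_conjDual : FiniteDimensional ℂ (E →L⋆[ℂ] ℂ) := by
  let b := Module.finBasis ℂ E
  let f : (E →L⋆[ℂ] ℂ) →ₗ[ℂ] (Fin (Module.finrank ℂ E) → ℂ) :=
    { toFun := fun β i => β (b i)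
      map_add' := fun _ _ => rfl
      map_smul' := fun _ _ => rfl }
  refine FiniteDimensional.of_injective f fun β γ h => ?_
  apply ContinuousLinearMap.coe_injective
  exact b.ext fun i => congrFun h i

instance finite_extL : Module.Finite ℂ (ExtL E) := by
  have htop : (⨆ i, (⋀[ℂ]^i (LFibre E) : Submodule ℂ (ExtL E))) = ⊤ :=
    (DirectSum.Decomposition.isInternal
      (fun i : ℕ => ⋀[ℂ]^i (LFibre E))).submodule_iSup_eq_top
  have hz : ∀ i, Module.finrank ℂ (LFibre E) < i →
      (⋀[ℂ]^i (LFibre E) : Submodule ℂ (ExtL E)) = ⊥ := by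
    intro i hi
    rw [← Submodule.finrank_eq_zero (R := ℂ), exteriorPower.finrank_eq,
      Nat.choose_eq_zero_of_lt hi]
  have hfin : (⨆ i : Fin (Module.finrank ℂ (LFibre E) + 1),
      (⋀[ℂ]^(i : ℕ) (LFibre E) : Submodule ℂ (ExtL E))) = ⊤ := by
    rw [eq_top_iff, ← htop]
    refine iSup_le fun i => ?_
    by_cases hi : Module.finrank ℂ (LFibre E) < i
    · rw [hz i hi]
      exact bot_le
    · exact le_iSup_of_le (⟨i, by omega⟩ : Fin (Module.finrank ℂ (LFibre E) + 1)) le_rfl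
  rw [Module.finite_def, ← hfin]
  exact Submodule.fg_iSup _ (fun i => Module.Finite.iff_fg.mp inferInstance)

/-- A norm on the finite-dimensional space `∧^• L_x`: the supremum norm of the coordinates in a
basis. It serves only to speak of derivatives of maps into `∧^• L_x`, for which the choice of the
norm is immaterial. -/
instance normedAddCommGroup_extL : NormedAddCommGroup (ExtL E) :=
  NormedAddCommGroup.induced (ExtL E) (Fin (Module.finrank ℂ (ExtL E)) → ℂ)
    (Module.finBasis ℂ (ExtL E)).equivFun (Module.finBasis ℂ (ExtL E)).equivFun.injective

instance normedSpace_extL : NormedSpace ℂ (ExtL E) :=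
  NormedSpace.induced ℂ (ExtL E) (Fin (Module.finrank ℂ (ExtL E)) → ℂ)
    (Module.finBasis ℂ (ExtL E)).equivFun

/-- The extension of an endomorphism `φ` of `L_x` to `∧^• L_x` as a derivation of degree `0`:
`φ(a₁ ∧ … ∧ aₖ) = ∑ᵢ a₁ ∧ … ∧ φ aᵢ ∧ … ∧ aₖ`. If `φ = ∑ₖ eᵏ ⊗ φ eₖ` as an element of `L* ⊗ L`, it is
`A ↦ ∑ₖ (φ eₖ) ∧ (eᵏ ⌋ A)`; it vanishes on scalars. -/
def derivExt (φ : LFibre E →L[ℂ] LFibre E) : ExtL E →ₗ[ℂ] ExtL E :=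
  ∑ k, LinearMap.mulLeft ℂ (ExteriorAlgebra.ι ℂ (φ (Module.finBasis ℂ (LFibre E) k))) ∘ₗ
    CliffordAlgebra.contractLeft ((Module.finBasis ℂ (LFibre E)).coord k)

/-- The covector `dzⁱ` (for the linear coordinates `zⁱ` of a basis of `E`) as a linear form
on `L_x`; it vanishes on `T^{*(0,1)}`. -/
def dz (i : Fin (Module.finrank ℂ E)) : Module.Dual ℂ (LFibre E) :=
  (Module.finBasis ℂ E).coord i ∘ₗ LinearMap.fst ℂ E (E →L⋆[ℂ] ℂ)

/-- The covector `dz̄ʲ` as an element of `T^{*(0,1)}`. -/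
def dzbar (j : Fin (Module.finrank ℂ E)) : E →L⋆[ℂ] ℂ :=
  ((starL ℂ : ℂ ≃L⋆[ℂ] ℂ) : ℂ →L⋆[ℂ] ℂ).comp
    (LinearMap.toContinuousLinearMap ((Module.finBasis ℂ E).coord j))

end Fibre

section Flat

variable {E : Type*} [NormedAddCommGroup E] [NormedSpace ℂ E] [FiniteDimensional ℂ E]

/-- The Wirtinger derivative `∂s/∂zⁱ = (∂s/∂xⁱ - i ∂s/∂yⁱ) / 2`. -/
def dWirtinger (i : Fin (Module.finrank ℂ E)) (s : E → ExtL E) (y : E) : ExtL E :=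
  (1 / 2 : ℂ) • (fderiv ℝ s y (Module.finBasis ℂ E i) -
    Complex.I • fderiv ℝ s y (Complex.I • Module.finBasis ℂ E i))

/-- The Wirtinger derivative `∂s/∂z̄ʲ = (∂s/∂xʲ + i ∂s/∂yʲ) / 2`. -/
def dbarWirtinger (j : Fin (Module.finrank ℂ E)) (s : E → ExtL E) (y : E) : ExtL E :=
  (1 / 2 : ℂ) • (fderiv ℝ s y (Module.finBasis ℂ E j) +
    Complex.I • fderiv ℝ s y (Complex.I • Module.finBasis ℂ E j))

end Flat

section Manifold

variable {E : Type*} [NormedAddCommGroup E] [NormedSpace ℂ E]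
variable {M : Type*} [TopologicalSpace M] [ChartedSpace E M]

section

variable [IsManifold 𝓘(ℂ, E) 1 M]

/-- The coordinate change of the bundle `L` at the point `z`, from the trivialization of the
preferred chart at `x` to that of the preferred chart at `y`: on vectors it is the derivative `T` of
the coordinate change, on covectors it is `β ↦ β ∘ T⁻¹`. -/
def coordChangeL (x y z : M) : LFibre E →L[ℂ] LFibre E :=
  (tangentCoordChange 𝓘(ℂ, E) x y z).prodMap
    (ContinuousLinearMap.precomp ℂ (tangentCoordChange 𝓘(ℂ, E) y x z))

/-- The coordinate expression, in the preferred chart at `x`, of a section `s` of `∧^• L`. -/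
def localRep (x : M) (s : M → ExtL E) (y : E) : ExtL E :=
  let z := (extChartAt 𝓘(ℂ, E) x).symm y
  ExteriorAlgebra.map (coordChangeL z x z).toLinearMap (s z)

/-- The coordinate expression, in the preferred chart at `x`, of a section `φ` of `End L`. -/
def localRepEnd (x : M) (φ : M → LFibre E →L[ℂ] LFibre E) (y : E) : LFibre E →L[ℂ] LFibre E :=
  let z := (extChartAt 𝓘(ℂ, E) x).symm y
  (coordChangeL z x z).comp ((φ z).comp (coordChangeL x z z))

/-- `φ ∈ C^∞(M, End L) = C^∞(M, L* ⊗ L)`; smooth means `C^∞` in the real sense. -/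
def IsSmoothEnd (φ : M → LFibre E →L[ℂ] LFibre E) : Prop :=
  ∀ x : M, ContDiffOn ℝ ∞ (localRepEnd x φ) (extChartAt 𝓘(ℂ, E) x).target

variable [FiniteDimensional ℂ E]

/-- `s ∈ C^∞(M, ∧^• L)`; smooth means `C^∞` in the real sense. -/
def IsSmoothSection (s : M → ExtL E) : Prop :=
  ∀ x : M, ContDiffOn ℝ ∞ (localRep x s) (extChartAt 𝓘(ℂ, E) x).target

/-- The Lie algebroid differential `∂̄ : C^∞(∧^k L) → C^∞(∧^{k+1} L)` of `L̄ ≅ L*`. In holomorphic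
coordinates `∂̄P = ∑ⱼ dz̄ʲ ∧ ∂P/∂z̄ʲ`: the frame `∂/∂zⁱ, dz̄ʲ` of `L` is dual to the frame
`dzⁱ, ∂/∂z̄ʲ` of `L̄`, all Courant brackets inside the latter frame vanish, and its anchor is
`dzⁱ ↦ 0`, `∂/∂z̄ʲ ↦ ∂/∂z̄ʲ`. -/
def dbar (P : M → ExtL E) (x : M) : ExtL E :=
  ∑ j, ExteriorAlgebra.ι ℂ ((0, dzbar j) : LFibre E) *
    dbarWirtinger j (localRep x P) (extChartAt 𝓘(ℂ, E) x x)

/-- The Schouten bracket on `C^∞(∧^• L)`, that is the extension of the Courant bracket of `L` as a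
graded biderivation with `⟦X + α, f⟧ = X f` and `⟦f, g⟧ = 0`. In holomorphic coordinates
`⟦P, Q⟧ = ∑ᵢ (P ⌊ dzⁱ) ∧ ∂Q/∂zⁱ - ∂P/∂zⁱ ∧ (dzⁱ ⌋ Q)`: all Courant brackets inside the frame
`∂/∂zⁱ, dz̄ʲ` of `L` vanish, and its anchor is `∂/∂zⁱ ↦ ∂/∂zⁱ`, `dz̄ʲ ↦ 0`. On sections `X + α`
and `Y + β` of `L` this is `[X, Y] + 𝓛_X β - 𝓛_Y α`, the Courant bracket on the isotropic `L`. -/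
def schouten (P Q : M → ExtL E) (x : M) : ExtL E :=
  ∑ i, (CliffordAlgebra.contractRight (P x) (dz i) *
      dWirtinger i (localRep x Q) (extChartAt 𝓘(ℂ, E) x x) -
    dWirtinger i (localRep x P) (extChartAt 𝓘(ℂ, E) x x) *
      CliffordAlgebra.contractLeft (dz i) (Q x))

end

section

variable [FiniteDimensional ℂ E]

/-- The action of a section `φ` of `End L` on the sections of `∧^• L`. -/
def act (φ : M → LFibre E →L[ℂ] LFibre E) (A : M → ExtL E) (x : M) : ExtL E :=
  derivExt (φ x) (A x)

end

/-- A section `Γ` of `∧² L` and a section `φ` of `L* ⊗ L` form a compatible pair. -/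
structure IsCompatiblePair [IsManifold 𝓘(ℂ, E) 1 M] [FiniteDimensional ℂ E]
    (Γ : M → ExtL E) (φ : M → LFibre E →L[ℂ] LFibre E) : Prop where
  smooth_left : IsSmoothSection Γ
  degree_two : ∀ x, Γ x ∈ ⋀[ℂ]^2 (LFibre E)
  smooth_right : IsSmoothEnd φ
  dbar_closed : dbar Γ = 0
  dbar_act : ∀ A : M → ExtL E, IsSmoothSection A →
    dbar (act φ A) - act φ (dbar A) = schouten Γ A
  act_schouten : ∀ A B : M → ExtL E, IsSmoothSection A → IsSmoothSection B →
    schouten (act φ A) B + schouten A (act φ B) = act φ (schouten A B)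
  act_wedge : ∀ A B : M → ExtL E, IsSmoothSection A → IsSmoothSection B →
    act φ (A * B) = act φ A * B + A * act φ B

/-- The component `Λ` of `Γ` in `T^{2,0} = ∧² T^{1,0}`. -/
def bivectorPart (Γ : M → ExtL E) (x : M) : ExtL E :=
  ExteriorAlgebra.map (projT (E := E)).toLinearMap (Γ x)

/-- The component `Ω` of `Γ` in `T^{*(0,2)} = ∧² T^{*(0,1)}`. -/
def formPart (Γ : M → ExtL E) (x : M) : ExtL E :=
  ExteriorAlgebra.map (projTstar (E := E)).toLinearMap (Γ x)

/-- The component `Γ̂` of a section `Γ` of `∧² L` in `T^{1,0} ⊗ T^{*(0,1)}`, the remaining summand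
of `∧² L = T^{2,0} ⊕ (T^{1,0} ⊗ T^{*(0,1)}) ⊕ T^{*(0,2)}`. -/
def mixedPart (Γ : M → ExtL E) (x : M) : ExtL E :=
  Γ x - bivectorPart Γ x - formPart Γ x

/-- The block `φ₁` of `φ` in `End(T^{1,0}, T^{1,0})`. -/
def block₁ (φ : M → LFibre E →L[ℂ] LFibre E) (x : M) : LFibre E →L[ℂ] LFibre E :=
  projT.comp ((φ x).comp projT)

/-- The block `φ₂` of `φ` in `End(T^{*(0,1)}, T^{*(0,1)})`. -/
def block₂ (φ : M → LFibre E →L[ℂ] LFibre E) (x : M) : LFibre E →L[ℂ] LFibre E :=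
  projTstar.comp ((φ x).comp projTstar)

/-- The block `φ₃` of `φ` in `End(T^{1,0}, T^{*(0,1)})`. -/
def block₃ (φ : M → LFibre E →L[ℂ] LFibre E) (x : M) : LFibre E →L[ℂ] LFibre E :=
  projTstar.comp ((φ x).comp projT)

/-- The block `φ₄` of `φ` in `End(T^{*(0,1)}, T^{1,0})`. -/
def block₄ (φ : M → LFibre E →L[ℂ] LFibre E) (x : M) : LFibre E →L[ℂ] LFibre E :=
  projT.comp ((φ x).comp projTstar)

end Manifold

end ComplexDGA

end

/-!
For `t ∈ ℂˣ`, let `t` act on `L` by multiplying `T^{1,0}` by `t` and fixing `T^{*(0,1)}`. The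
induced action on `∧^• L` commutes with `∂̄` and satisfies `⟦t · A, t · B⟧ = t (t · ⟦A, B⟧)`, hence
it carries a compatible pair `(Γ, φ)` to the compatible pair `(t⁻¹ (t · Γ), t φ t⁻¹)`, which equals
`t (Λ, φ₄) + (Γ̂, φ₁ + φ₂) + t⁻¹ (Ω, φ₃)`. Compatible pairs form a complex vector space, so each
coefficient of this Laurent polynomial in `t` is compatible as soon as all its values are.
-/

noncomputable section

namespace ComplexDGA

section Algebra

theorem mem_of_forall_laurent_mem {K V : Type*} [Field K] [CharZero K] [AddCommMonoid V]
    [Module K V] (S : Submodule K V) {a b c : V}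
    (h : ∀ t : Kˣ, (t : K) • a + b + (t : K)⁻¹ • c ∈ S) : a ∈ S ∧ c ∈ S ∧ b ∈ S := by
  let : AddCommGroup V := Module.addCommMonoidToAddCommGroup K
  have h₁ : a + b + c ∈ S := by simpa using h 1
  have h₂ : -a + b - c ∈ S := by simpa [sub_eq_add_neg, inv_neg] using h (-1)
  have h₃ : (2 : K) • a + b + (2 : K)⁻¹ • c ∈ S := h (Units.mk0 2 two_ne_zero)
  have hb : b ∈ S := by
    convert S.smul_mem (2⁻¹ : K) (S.add_mem h₁ h₂) using 1
    module
  have hac : a + c ∈ S := by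
    convert S.sub_mem h₁ hb using 1
    module
  have ha : a ∈ S := by
    convert S.smul_mem (3⁻¹ : K)
      (S.sub_mem (S.smul_mem (2 : K) (S.sub_mem h₃ hb)) hac) using 1
    module
  exact ⟨ha, by simpa using S.sub_mem hac ha, hb⟩

variable {R V W : Type*} [CommRing R] [AddCommGroup V] [Module R V] [AddCommGroup W] [Module R W]

theorem contractLeft_map {Q₁ : QuadraticForm R V} {Q₂ : QuadraticForm R W} (f : Q₁ →qᵢ Q₂)
    (d : Module.Dual R W) (a : CliffordAlgebra Q₁) :
    CliffordAlgebra.contractLeft d (CliffordAlgebra.map f a) =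
      CliffordAlgebra.map f (CliffordAlgebra.contractLeft (d ∘ₗ f.toLinearMap) a) := by
  induction a using CliffordAlgebra.left_induction with
  | algebraMap r =>
    simp only [AlgHom.commutes, CliffordAlgebra.contractLeft_algebraMap, map_zero]
  | add a b ha hb => simp only [map_add, ha, hb]
  | ι_mul a v ha =>
    simp only [map_mul, map_sub, map_smul, CliffordAlgebra.map_apply_ι,
      CliffordAlgebra.contractLeft_ι_mul, ha]
    rfl

theorem contractRight_map {Q₁ : QuadraticForm R V} {Q₂ : QuadraticForm R W} (f : Q₁ →qᵢ Q₂)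
    (d : Module.Dual R W) (a : CliffordAlgebra Q₁) :
    CliffordAlgebra.contractRight (CliffordAlgebra.map f a) d =
      CliffordAlgebra.map f (CliffordAlgebra.contractRight a (d ∘ₗ f.toLinearMap)) := by
  induction a using CliffordAlgebra.right_induction with
  | algebraMap r =>
    simp only [AlgHom.commutes, CliffordAlgebra.contractRight_algebraMap, map_zero]
  | add a b ha hb => simp only [map_add, LinearMap.add_apply, ha, hb]
  | mul_ι v a ha =>
    simp only [map_mul, map_sub, map_smul, CliffordAlgebra.map_apply_ι,
      CliffordAlgebra.contractRight_mul_ι, ha]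
    rfl

theorem contractLeft_exteriorMap (f : V →ₗ[R] W) (d : Module.Dual R W) (a : ExteriorAlgebra R V) :
    CliffordAlgebra.contractLeft d (ExteriorAlgebra.map f a) =
      ExteriorAlgebra.map f (CliffordAlgebra.contractLeft (d ∘ₗ f) a) :=
  contractLeft_map { f with map_app' := fun _ => rfl } d a

theorem contractRight_exteriorMap (f : V →ₗ[R] W) (d : Module.Dual R W)
    (a : ExteriorAlgebra R V) :
    CliffordAlgebra.contractRight (ExteriorAlgebra.map f a) d =
      ExteriorAlgebra.map f (CliffordAlgebra.contractRight a (d ∘ₗ f)) :=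
  contractRight_map { f with map_app' := fun _ => rfl } d a

theorem map_mem_exteriorPower (f : V →ₗ[R] W) {n : ℕ} {a : ExteriorAlgebra R V}
    (ha : a ∈ ⋀[R]^n V) : ExteriorAlgebra.map f a ∈ ⋀[R]^n W := by
  have hle : (LinearMap.range (ExteriorAlgebra.ι R (M := V))).map
      (ExteriorAlgebra.map f).toLinearMap ≤ LinearMap.range (ExteriorAlgebra.ι R) := by
    rw [ExteriorAlgebra.ι_range_map_map]
    exact LinearMap.map_le_range
  have hmap := Submodule.mem_map_of_mem (f := (ExteriorAlgebra.map f).toLinearMap) ha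
  rw [Submodule.map_pow] at hmap
  exact pow_le_pow_left' hle n hmap

end Algebra

section Derivation

theorem contDiff_bilinearMap {𝕜 V W F : Type*} [NontriviallyNormedField 𝕜] [CompleteSpace 𝕜]
    [NormedAddCommGroup V] [NormedSpace 𝕜 V] [FiniteDimensional 𝕜 V] [NormedAddCommGroup W]
    [NormedSpace 𝕜 W] [FiniteDimensional 𝕜 W] [NormedAddCommGroup F] [NormedSpace 𝕜 F]
    (f : V →ₗ[𝕜] W →ₗ[𝕜] F) {n : WithTop ℕ∞} : ContDiff 𝕜 n fun p : V × W => f p.1 p.2 :=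
  f.toContinuousBilinearMap.isBoundedBilinearMap.contDiff

variable {E : Type*} [NormedAddCommGroup E] [NormedSpace ℂ E] [FiniteDimensional ℂ E]

theorem derivExt_algebraMap (φ : LFibre E →L[ℂ] LFibre E) (r : ℂ) :
    derivExt φ (algebraMap ℂ (ExtL E) r) = 0 := by
  simp [derivExt, CliffordAlgebra.contractLeft_algebraMap]

theorem derivExt_ι_mul (φ : LFibre E →L[ℂ] LFibre E) (v : LFibre E) (a : ExtL E) :
    derivExt φ (ExteriorAlgebra.ι ℂ v * a) =
      ExteriorAlgebra.ι ℂ (φ v) * a + ExteriorAlgebra.ι ℂ v * derivExt φ a := by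
  set b := Module.finBasis ℂ (LFibre E)
  have hφv : φ v = ∑ k, b.coord k v • φ (b k) := by
    conv_lhs => rw [← b.sum_repr v]
    simp only [map_sum, map_smul, Module.Basis.coord_apply]
  have hswap (k) : ExteriorAlgebra.ι ℂ (φ (b k)) * ExteriorAlgebra.ι ℂ v =
      -(ExteriorAlgebra.ι ℂ v * ExteriorAlgebra.ι ℂ (φ (b k))) :=
    eq_neg_of_add_eq_zero_left (ExteriorAlgebra.ι_add_mul_swap _ _)
  have hcontract (k) : CliffordAlgebra.contractLeft (b.coord k) (ExteriorAlgebra.ι ℂ v * a) =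
      b.coord k v • a - ExteriorAlgebra.ι ℂ v * CliffordAlgebra.contractLeft (b.coord k) a :=
    CliffordAlgebra.contractLeft_ι_mul _ _ _
  simp only [derivExt, LinearMap.sum_apply, LinearMap.comp_apply, LinearMap.mulLeft_apply]
  rw [hφv, map_sum, Finset.sum_mul, Finset.mul_sum, ← Finset.sum_add_distrib]
  refine Finset.sum_congr rfl fun k _ => ?_
  rw [hcontract, mul_sub, ← mul_assoc, hswap, map_smul, smul_mul_assoc, mul_smul_comm, neg_mul,
    sub_neg_eq_add, mul_assoc]

theorem derivExt_mul (φ : LFibre E →L[ℂ] LFibre E) (a b : ExtL E) :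
    derivExt φ (a * b) = derivExt φ a * b + a * derivExt φ b := by
  induction a using CliffordAlgebra.left_induction with
  | algebraMap r =>
    rw [derivExt_algebraMap, zero_mul, zero_add, ← Algebra.smul_def, ← Algebra.smul_def, map_smul]
  | add a a' ha ha' => simp only [add_mul, map_add, ha, ha', add_add_add_comm]
  | ι_mul a v ha =>
    rw [mul_assoc, derivExt_ι_mul, derivExt_ι_mul, ha, mul_add, add_mul]
    simp only [mul_assoc, add_assoc]

theorem derivExt_add (φ ψ : LFibre E →L[ℂ] LFibre E) :
    derivExt (φ + ψ) = derivExt φ + derivExt ψ := by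
  refine LinearMap.ext fun a => ?_
  simp [derivExt, add_mul, Finset.sum_add_distrib]

theorem derivExt_smul (c : ℂ) (φ : LFibre E →L[ℂ] LFibre E) :
    derivExt (c • φ) = c • derivExt φ := by
  refine LinearMap.ext fun a => ?_
  simp [derivExt, Finset.smul_sum]

/-- `derivExt` as a bilinear map; bilinearity yields the smoothness of `act φ s`. -/
def derivExtBilin : (LFibre E →L[ℂ] LFibre E) →ₗ[ℂ] ExtL E →ₗ[ℂ] ExtL E where
  toFun := derivExt
  map_add' := derivExt_add
  map_smul' := derivExt_smul

theorem contDiff_derivExt {n : WithTop ℕ∞} :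
    ContDiff ℂ n fun p : (LFibre E →L[ℂ] LFibre E) × ExtL E => derivExt p.1 p.2 :=
  contDiff_bilinearMap (𝕜 := ℂ) (V := LFibre E →L[ℂ] LFibre E) (W := ExtL E) (F := ExtL E)
    derivExtBilin

theorem map_derivExt {f φ ψ : LFibre E →L[ℂ] LFibre E} (h : f.comp φ = ψ.comp f) (a : ExtL E) :
    ExteriorAlgebra.map f.toLinearMap (derivExt φ a) =
      derivExt ψ (ExteriorAlgebra.map f.toLinearMap a) := by
  induction a using CliffordAlgebra.left_induction with
  | algebraMap r => simp only [derivExt_algebraMap, AlgHom.commutes, map_zero]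
  | add a b ha hb => simp only [map_add, ha, hb]
  | ι_mul a v ha =>
    have hv : f (φ v) = ψ (f v) := DFunLike.congr_fun h v
    rw [derivExt_ι_mul, map_add, map_mul, map_mul, map_mul, ExteriorAlgebra.map_apply_ι,
      ExteriorAlgebra.map_apply_ι, derivExt_ι_mul, ha]
    simp [hv]

end Derivation

section Scaling

variable {E : Type*} [NormedAddCommGroup E] [NormedSpace ℂ E]

/-- The action of `t ∈ ℂˣ` on `L_x` with weight `1` on `T^{1,0}` and weight `0` on `T^{*(0,1)}`. -/
def scaleL (t : ℂˣ) : LFibre E →L[ℂ] LFibre E := (t : ℂ) • projT + projTstar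

theorem scaleL_apply (t : ℂˣ) (v : LFibre E) : scaleL t v = ((t : ℂ) • v.1, v.2) := by
  simp [scaleL, projT, projTstar]

theorem scaleL_comp_scaleL_inv (t : ℂˣ) :
    (scaleL t : LFibre E →L[ℂ] LFibre E).comp (scaleL t⁻¹) = .id ℂ _ := by
  refine ContinuousLinearMap.ext fun v => ?_
  simp [scaleL_apply]

/-- The algebra endomorphism of `∧^• L_x` induced by `scaleL t`. -/
def scaleExt (t : ℂˣ) : ExtL E →ₐ[ℂ] ExtL E :=
  ExteriorAlgebra.map (scaleL t).toLinearMap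

theorem scaleExt_scaleExt_inv (t : ℂˣ) (a : ExtL E) : scaleExt t (scaleExt t⁻¹ a) = a := by
  rw [scaleExt, scaleExt, ← AlgHom.comp_apply, ExteriorAlgebra.map_comp_map,
    ← ContinuousLinearMap.toLinearMap_comp, scaleL_comp_scaleL_inv, ContinuousLinearMap.coe_id,
    ExteriorAlgebra.map_id, AlgHom.id_apply]

theorem scaleExt_of_mem_exteriorPower_two (t : ℂˣ) {a : ExtL E} (ha : a ∈ ⋀[ℂ]^2 (LFibre E)) :
    scaleExt t a = (t : ℂ) ^ 2 • ExteriorAlgebra.map projT.toLinearMap a +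
      (t : ℂ) • (a - ExteriorAlgebra.map projT.toLinearMap a -
        ExteriorAlgebra.map projTstar.toLinearMap a) +
      ExteriorAlgebra.map projTstar.toLinearMap a := by
  rw [ExteriorAlgebra.exteriorPower, pow_two] at ha
  induction ha using Submodule.mul_induction_on' with
  | mem_mul_mem a ha b hb =>
    obtain ⟨u, rfl⟩ := ha
    obtain ⟨v, rfl⟩ := hb
    have hsplit (w : LFibre E) : ExteriorAlgebra.ι ℂ w =
        ExteriorAlgebra.ι ℂ (projT w) + ExteriorAlgebra.ι ℂ (projTstar w) := by
      rw [← map_add]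
      congr 1
      ext <;> simp [projT, projTstar]
    have hscale (w : LFibre E) : scaleExt t (ExteriorAlgebra.ι ℂ w) =
        (t : ℂ) • ExteriorAlgebra.ι ℂ (projT w) + ExteriorAlgebra.ι ℂ (projTstar w) := by
      rw [scaleExt, ExteriorAlgebra.map_apply_ι, ← map_smul, ← map_add]
      rfl
    simp only [map_mul, hscale, ExteriorAlgebra.map_apply_ι, ContinuousLinearMap.coe_coe]
    rw [hsplit u, hsplit v]
    simp only [add_mul, mul_add, smul_mul_assoc, mul_smul_comm]
    module
  | add a _ b _ ha hb =>
    simp only [map_add, ha, hb]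
    module

/-- Conjugation of endomorphisms of `L_x` by `scaleL t`. -/
def conjL (t : ℂˣ) : (LFibre E →L[ℂ] LFibre E) →L[ℂ] (LFibre E →L[ℂ] LFibre E) :=
  (ContinuousLinearMap.postcomp _ (scaleL t)).comp (ContinuousLinearMap.precomp _ (scaleL t⁻¹))

theorem conjL_apply (t : ℂˣ) (φ : LFibre E →L[ℂ] LFibre E) :
    conjL t φ = (scaleL t).comp (φ.comp (scaleL t⁻¹)) := rfl

theorem contDiff_conjL (t : ℂˣ) {n : WithTop ℕ∞} :
    ContDiff ℂ n (conjL t : (LFibre E →L[ℂ] LFibre E) → LFibre E →L[ℂ] LFibre E) :=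
  ContinuousLinearMap.contDiff (𝕜 := ℂ) (E := LFibre E →L[ℂ] LFibre E)
    (F := LFibre E →L[ℂ] LFibre E) (conjL t)

theorem scaleL_comp_eq_conjL_comp (t : ℂˣ) (φ : LFibre E →L[ℂ] LFibre E) :
    (scaleL t).comp φ = (conjL t φ).comp (scaleL t) := by
  have hinv := scaleL_comp_scaleL_inv (E := E) t⁻¹
  rw [inv_inv] at hinv
  rw [conjL_apply, ContinuousLinearMap.comp_assoc, ContinuousLinearMap.comp_assoc, hinv,
    ContinuousLinearMap.comp_id]

section Components

variable {M : Type*}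

theorem scaleExt_comp_eq_parts (t : ℂˣ) {Γ : M → ExtL E}
    (hΓ : ∀ x, Γ x ∈ ⋀[ℂ]^2 (LFibre E)) :
    (t : ℂ)⁻¹ • (scaleExt t ∘ Γ) =
      (t : ℂ) • bivectorPart Γ + mixedPart Γ + (t : ℂ)⁻¹ • formPart Γ := by
  funext x
  simp only [Pi.smul_apply, Pi.add_apply, Function.comp_apply,
    scaleExt_of_mem_exteriorPower_two t (hΓ x), smul_add, pow_two, mul_smul,
    inv_smul_smul₀ t.ne_zero]
  rfl

theorem conjL_comp_eq_blocks (t : ℂˣ) (φ : M → LFibre E →L[ℂ] LFibre E) :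
    conjL t ∘ φ = (t : ℂ) • block₄ φ + (block₁ φ + block₂ φ) + (t : ℂ)⁻¹ • block₃ φ := by
  funext x
  refine ContinuousLinearMap.ext fun v => ?_
  simp only [Function.comp_apply, conjL_apply, scaleL, Units.val_inv_eq_inv_val, Pi.add_apply,
    Pi.smul_apply, block₁, block₂, block₃, block₄, ContinuousLinearMap.comp_apply, add_apply,
    smul_apply, map_add, map_smul, smul_add, inv_smul_smul₀ t.ne_zero]
  abel

theorem bivectorPart_add_formPart_add_mixedPart (Γ : M → ExtL E) :
    bivectorPart Γ + (formPart Γ + mixedPart Γ) = Γ := by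
  funext x
  simp only [Pi.add_apply, mixedPart]
  abel

theorem block₄_add_block₃_add_block₁_add_block₂ (φ : M → LFibre E →L[ℂ] LFibre E) :
    block₄ φ + (block₃ φ + (block₁ φ + block₂ φ)) = φ := by
  have hconj : conjL 1 ∘ φ = φ := by
    funext x
    refine ContinuousLinearMap.ext fun v => ?_
    simp [conjL_apply, scaleL_apply]
  refine Eq.trans ?_ ((conjL_comp_eq_blocks 1 φ).symm.trans hconj)
  rw [Units.val_one, inv_one, one_smul, one_smul]
  abel

end Components

variable [FiniteDimensional ℂ E]

theorem dz_comp_scaleL (t : ℂˣ) (i : Fin (Module.finrank ℂ E)) :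
    dz i ∘ₗ (scaleL t).toLinearMap = (t : ℂ) • dz i := by
  ext a <;> simp [dz, scaleL_apply]

theorem contractLeft_scaleExt (t : ℂˣ) (i : Fin (Module.finrank ℂ E)) (a : ExtL E) :
    CliffordAlgebra.contractLeft (dz i) (scaleExt t a) =
      (t : ℂ) • scaleExt t (CliffordAlgebra.contractLeft (dz i) a) := by
  rw [scaleExt, contractLeft_exteriorMap, dz_comp_scaleL, map_smul, LinearMap.smul_apply, map_smul]

theorem contractRight_scaleExt (t : ℂˣ) (i : Fin (Module.finrank ℂ E)) (a : ExtL E) :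
    CliffordAlgebra.contractRight (scaleExt t a) (dz i) =
      (t : ℂ) • scaleExt t (CliffordAlgebra.contractRight a (dz i)) := by
  rw [scaleExt, contractRight_exteriorMap, dz_comp_scaleL, map_smul, map_smul]

theorem scaleExt_ι_dzbar (t : ℂˣ) (j : Fin (Module.finrank ℂ E)) :
    scaleExt t (ExteriorAlgebra.ι ℂ ((0, dzbar j) : LFibre E)) =
      ExteriorAlgebra.ι ℂ ((0, dzbar j) : LFibre E) := by
  rw [scaleExt, ExteriorAlgebra.map_apply_ι, ContinuousLinearMap.coe_coe, scaleL_apply, smul_zero]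

end Scaling

section Wirtinger

theorem fderiv_linearMap_comp {E F G : Type*} [NormedAddCommGroup E] [NormedSpace ℝ E]
    [NormedAddCommGroup F] [NormedSpace ℂ F] [FiniteDimensional ℂ F] [NormedAddCommGroup G]
    [NormedSpace ℂ G] (T : F →ₗ[ℂ] G) {s : E → F} {y : E} (hs : DifferentiableAt ℝ s y) (v : E) :
    fderiv ℝ (T ∘ s) y v = T (fderiv ℝ s y v) := by
  have hcomp : HasFDerivAt (T ∘ s)
      ((T.toContinuousLinearMap.restrictScalars ℝ).comp (fderiv ℝ s y)) y :=
    (T.toContinuousLinearMap.restrictScalars ℝ).hasFDerivAt.comp y hs.hasFDerivAt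
  rw [hcomp.fderiv]
  rfl

variable {E : Type*} [NormedAddCommGroup E] [NormedSpace ℂ E] [FiniteDimensional ℂ E]
variable {i : Fin (Module.finrank ℂ E)} {s r : E → ExtL E} {y : E}

theorem dWirtinger_linearMap_comp (T : ExtL E →ₗ[ℂ] ExtL E) (hs : DifferentiableAt ℝ s y) :
    dWirtinger i (T ∘ s) y = T (dWirtinger i s y) := by
  simp only [dWirtinger, fderiv_linearMap_comp T hs, map_smul, map_sub]

theorem dbarWirtinger_linearMap_comp (T : ExtL E →ₗ[ℂ] ExtL E) (hs : DifferentiableAt ℝ s y) :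
    dbarWirtinger i (T ∘ s) y = T (dbarWirtinger i s y) := by
  simp only [dbarWirtinger, fderiv_linearMap_comp T hs, map_smul, map_add]

theorem dWirtinger_smul (c : ℂ) (hs : DifferentiableAt ℝ s y) :
    dWirtinger i (c • s) y = c • dWirtinger i s y := by
  simp only [dWirtinger, fderiv_const_smul hs, smul_apply, smul_sub, smul_comm c]

theorem dbarWirtinger_smul (c : ℂ) (hs : DifferentiableAt ℝ s y) :
    dbarWirtinger i (c • s) y = c • dbarWirtinger i s y := by
  simp only [dbarWirtinger, fderiv_const_smul hs, smul_apply, smul_add, smul_comm c]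

theorem dWirtinger_add (hs : DifferentiableAt ℝ s y) (hr : DifferentiableAt ℝ r y) :
    dWirtinger i (s + r) y = dWirtinger i s y + dWirtinger i r y := by
  simp only [dWirtinger, fderiv_add hs hr, add_apply, smul_add, smul_sub]
  abel

theorem dbarWirtinger_add (hs : DifferentiableAt ℝ s y) (hr : DifferentiableAt ℝ r y) :
    dbarWirtinger i (s + r) y = dbarWirtinger i s y + dbarWirtinger i r y := by
  simp only [dbarWirtinger, fderiv_add hs hr, add_apply, smul_add]
  abel

end Wirtinger

section LocalRep

variable {E : Type*} [NormedAddCommGroup E] [NormedSpace ℂ E]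
variable {M : Type*} [TopologicalSpace M] [ChartedSpace E M] [IsManifold 𝓘(ℂ, E) 1 M]

theorem scaleL_comp_coordChangeL (t : ℂˣ) (x y z : M) :
    (scaleL t).comp (coordChangeL x y z) =
      (coordChangeL x y z).comp (scaleL t : LFibre E →L[ℂ] LFibre E) := by
  refine ContinuousLinearMap.ext fun v => ?_
  simp [coordChangeL, scaleL_apply]

theorem coordChangeL_comp_coordChangeL {x y z : M}
    (hx : z ∈ (extChartAt 𝓘(ℂ, E) x).source) (hy : z ∈ (extChartAt 𝓘(ℂ, E) y).source) :
    (coordChangeL y x z).comp (coordChangeL x y z) = .id ℂ (LFibre E) := by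
  have hcancel (v : E) :
      tangentCoordChange 𝓘(ℂ, E) y x z (tangentCoordChange 𝓘(ℂ, E) x y z v) = v := by
    rw [tangentCoordChange_comp ⟨⟨hx, hy⟩, hx⟩, tangentCoordChange_self hx]
  refine ContinuousLinearMap.ext fun a => Prod.ext (hcancel a.1) ?_
  exact ContinuousLinearMap.ext fun v => congrArg a.2 (hcancel v)

theorem localRep_zero (x : M) : localRep x (0 : M → ExtL E) = 0 := by
  funext y
  simp [localRep]

theorem localRep_add (x : M) (s r : M → ExtL E) :
    localRep x (s + r) = localRep x s + localRep x r := by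
  funext y
  simp [localRep]

theorem localRep_smul (x : M) (c : ℂ) (s : M → ExtL E) :
    localRep x (c • s) = c • localRep x s := by
  funext y
  simp [localRep]

theorem localRep_scaleExt (x : M) (t : ℂˣ) (s : M → ExtL E) :
    localRep x (scaleExt t ∘ s) = scaleExt t ∘ localRep x s := by
  funext y
  simp only [localRep, scaleExt, Function.comp_apply]
  rw [← AlgHom.comp_apply, ← AlgHom.comp_apply, ExteriorAlgebra.map_comp_map,
    ExteriorAlgebra.map_comp_map, ← ContinuousLinearMap.toLinearMap_comp,
    ← ContinuousLinearMap.toLinearMap_comp, scaleL_comp_coordChangeL]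

theorem localRepEnd_zero (x : M) : localRepEnd x (0 : M → LFibre E →L[ℂ] LFibre E) = 0 := by
  funext y
  simp [localRepEnd]

theorem localRepEnd_add (x : M) (φ ψ : M → LFibre E →L[ℂ] LFibre E) :
    localRepEnd x (φ + ψ) = localRepEnd x φ + localRepEnd x ψ := by
  funext y
  simp [localRepEnd, ContinuousLinearMap.add_comp, ContinuousLinearMap.comp_add]

theorem localRepEnd_smul (x : M) (c : ℂ) (φ : M → LFibre E →L[ℂ] LFibre E) :
    localRepEnd x (c • φ) = c • localRepEnd x φ := by
  funext y
  simp [localRepEnd, ContinuousLinearMap.smul_comp]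

theorem localRepEnd_conjL (x : M) (t : ℂˣ) (φ : M → LFibre E →L[ℂ] LFibre E) :
    localRepEnd x (conjL t ∘ φ) = conjL t ∘ localRepEnd x φ := by
  funext y
  simp only [localRepEnd, Function.comp_apply, conjL_apply, ContinuousLinearMap.comp_assoc,
    scaleL_comp_coordChangeL]
  simp only [← ContinuousLinearMap.comp_assoc, scaleL_comp_coordChangeL]

theorem localRep_act [FiniteDimensional ℂ E] (x : M) (φ : M → LFibre E →L[ℂ] LFibre E)
    (s : M → ExtL E) {y : E} (hy : y ∈ (extChartAt 𝓘(ℂ, E) x).target) :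
    localRep x (act φ s) y = derivExt (localRepEnd x φ y) (localRep x s y) := by
  refine map_derivExt ?_ _
  have hz := (extChartAt 𝓘(ℂ, E) x).map_target hy
  rw [localRepEnd, ContinuousLinearMap.comp_assoc, ContinuousLinearMap.comp_assoc,
    coordChangeL_comp_coordChangeL (mem_extChartAt_source _) hz, ContinuousLinearMap.comp_id]

end LocalRep

section Smooth

variable {E : Type*} [NormedAddCommGroup E] [NormedSpace ℂ E]
variable {M : Type*} [TopologicalSpace M] [ChartedSpace E M] [IsManifold 𝓘(ℂ, E) 1 M]

namespace IsSmoothEnd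

variable {φ ψ : M → LFibre E →L[ℂ] LFibre E}

protected theorem zero : IsSmoothEnd (0 : M → LFibre E →L[ℂ] LFibre E) := fun x => by
  rw [localRepEnd_zero]
  exact contDiffOn_const

protected theorem add (hφ : IsSmoothEnd φ) (hψ : IsSmoothEnd ψ) : IsSmoothEnd (φ + ψ) := fun x => by
  rw [localRepEnd_add]
  exact (hφ x).add (hψ x)

protected theorem smul (c : ℂ) (hφ : IsSmoothEnd φ) : IsSmoothEnd (c • φ) := fun x => by
  rw [localRepEnd_smul]
  exact (hφ x).const_smul c

protected theorem conjL (t : ℂˣ) (hφ : IsSmoothEnd φ) : IsSmoothEnd (conjL t ∘ φ) := fun x => by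
  rw [localRepEnd_conjL]
  exact ((contDiff_conjL (E := E) t).restrict_scalars ℝ).comp_contDiffOn (hφ x)

end IsSmoothEnd

namespace IsSmoothSection

variable [FiniteDimensional ℂ E] {s r : M → ExtL E}

protected theorem zero : IsSmoothSection (0 : M → ExtL E) := fun x => by
  rw [localRep_zero]
  exact contDiffOn_const

protected theorem add (hs : IsSmoothSection s) (hr : IsSmoothSection r) :
    IsSmoothSection (s + r) := fun x => by
  rw [localRep_add]
  exact (hs x).add (hr x)

protected theorem smul (c : ℂ) (hs : IsSmoothSection s) : IsSmoothSection (c • s) := fun x => by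
  rw [localRep_smul]
  exact (hs x).const_smul c

protected theorem scaleExt (t : ℂˣ) (hs : IsSmoothSection s) :
    IsSmoothSection (scaleExt t ∘ s) := fun x => by
  rw [localRep_scaleExt]
  let T := LinearMap.toContinuousLinearMap (ComplexDGA.scaleExt (E := E) t).toLinearMap
  exact (T.contDiff.restrict_scalars ℝ).comp_contDiffOn (hs x)

protected theorem act {φ : M → LFibre E →L[ℂ] LFibre E} (hφ : IsSmoothEnd φ)
    (hs : IsSmoothSection s) : IsSmoothSection (act φ s) := fun x =>
  (((contDiff_derivExt (E := E)).restrict_scalars ℝ).comp_contDiffOn ((hφ x).prodMk (hs x))).congr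
    fun _ hy => localRep_act x φ s hy

theorem differentiableAt (hs : IsSmoothSection s) (x : M) :
    DifferentiableAt ℝ (localRep x s) (extChartAt 𝓘(ℂ, E) x x) :=
  ((hs x).differentiableOn (by simp)).differentiableAt (extChartAt_target_mem_nhds x)

theorem exists_scaleExt_comp_eq (t : ℂˣ) (hs : IsSmoothSection s) :
    ∃ r : M → ExtL E, IsSmoothSection r ∧ ComplexDGA.scaleExt t ∘ r = s :=
  ⟨_, hs.scaleExt t⁻¹, funext fun _ => scaleExt_scaleExt_inv t _⟩

end IsSmoothSection

end Smooth

section Act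

variable {E : Type*} [NormedAddCommGroup E] [NormedSpace ℂ E] [FiniteDimensional ℂ E]
variable {M : Type*}

theorem act_zero_left (A : M → ExtL E) : act 0 A = 0 :=
  funext fun _ => LinearMap.congr_fun (map_zero derivExtBilin) _

theorem act_add_left (φ ψ : M → LFibre E →L[ℂ] LFibre E) (A : M → ExtL E) :
    act (φ + ψ) A = act φ A + act ψ A :=
  funext fun _ => LinearMap.congr_fun (derivExt_add _ _) _

theorem act_smul_left (c : ℂ) (φ : M → LFibre E →L[ℂ] LFibre E) (A : M → ExtL E) :
    act (c • φ) A = c • act φ A :=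
  funext fun _ => LinearMap.congr_fun (derivExt_smul _ _) _

theorem act_smul_right (c : ℂ) (φ : M → LFibre E →L[ℂ] LFibre E) (A : M → ExtL E) :
    act φ (c • A) = c • act φ A :=
  funext fun _ => map_smul (derivExt _) _ _

theorem act_mul (φ : M → LFibre E →L[ℂ] LFibre E) (A B : M → ExtL E) :
    act φ (A * B) = act φ A * B + A * act φ B :=
  funext fun _ => derivExt_mul _ _ _

theorem act_scaleExt (t : ℂˣ) (φ : M → LFibre E →L[ℂ] LFibre E) (A : M → ExtL E) :
    act (conjL t ∘ φ) (scaleExt t ∘ A) = scaleExt t ∘ act φ A :=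
  funext fun _ => (map_derivExt (scaleL_comp_eq_conjL_comp t _) _).symm

end Act

section Operators

variable {E : Type*} [NormedAddCommGroup E] [NormedSpace ℂ E] [FiniteDimensional ℂ E]
variable {M : Type*} [TopologicalSpace M] [ChartedSpace E M] [IsManifold 𝓘(ℂ, E) 1 M]
variable {A B : M → ExtL E}

theorem dbar_add (hA : IsSmoothSection A) (hB : IsSmoothSection B) :
    dbar (A + B) = dbar A + dbar B := by
  funext x
  simp only [dbar, Pi.add_apply, localRep_add,
    dbarWirtinger_add (hA.differentiableAt x) (hB.differentiableAt x), mul_add,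
    Finset.sum_add_distrib]

theorem dbar_smul (c : ℂ) (hA : IsSmoothSection A) : dbar (c • A) = c • dbar A := by
  funext x
  simp only [dbar, Pi.smul_apply, localRep_smul, dbarWirtinger_smul c (hA.differentiableAt x),
    mul_smul_comm, Finset.smul_sum]

theorem dbar_scaleExt (t : ℂˣ) (hA : IsSmoothSection A) :
    dbar (scaleExt t ∘ A) = scaleExt t ∘ dbar A := by
  funext x
  have hderiv (j) : dbarWirtinger j (scaleExt t ∘ localRep x A) (extChartAt 𝓘(ℂ, E) x x) =
      scaleExt t (dbarWirtinger j (localRep x A) (extChartAt 𝓘(ℂ, E) x x)) :=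
    dbarWirtinger_linearMap_comp (scaleExt t).toLinearMap (hA.differentiableAt x)
  simp only [dbar, Function.comp_apply, localRep_scaleExt, hderiv, map_sum, map_mul,
    scaleExt_ι_dzbar]

theorem schouten_add_left (C : M → ExtL E) (hA : IsSmoothSection A) (hB : IsSmoothSection B) :
    schouten (A + B) C = schouten A C + schouten B C := by
  funext x
  simp only [schouten, Pi.add_apply, localRep_add,
    dWirtinger_add (hA.differentiableAt x) (hB.differentiableAt x), add_mul, map_add,
    LinearMap.add_apply, ← Finset.sum_add_distrib, add_sub_add_comm]

theorem schouten_add_right (C : M → ExtL E) (hA : IsSmoothSection A) (hB : IsSmoothSection B) :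
    schouten C (A + B) = schouten C A + schouten C B := by
  funext x
  simp only [schouten, Pi.add_apply, localRep_add,
    dWirtinger_add (hA.differentiableAt x) (hB.differentiableAt x), mul_add, map_add,
    ← Finset.sum_add_distrib, add_sub_add_comm]

theorem schouten_smul_left (c : ℂ) (C : M → ExtL E) (hA : IsSmoothSection A) :
    schouten (c • A) C = c • schouten A C := by
  funext x
  simp only [schouten, Pi.smul_apply, localRep_smul, dWirtinger_smul c (hA.differentiableAt x),
    map_smul, LinearMap.smul_apply, smul_mul_assoc, Finset.smul_sum, smul_sub]

theorem schouten_smul_right (c : ℂ) (C : M → ExtL E) (hA : IsSmoothSection A) :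
    schouten C (c • A) = c • schouten C A := by
  funext x
  simp only [schouten, Pi.smul_apply, localRep_smul, dWirtinger_smul c (hA.differentiableAt x),
    map_smul, mul_smul_comm, Finset.smul_sum, smul_sub]

theorem schouten_scaleExt (t : ℂˣ) (hA : IsSmoothSection A) (hB : IsSmoothSection B) :
    schouten (scaleExt t ∘ A) (scaleExt t ∘ B) = (t : ℂ) • (scaleExt t ∘ schouten A B) := by
  funext x
  have hderiv {C : M → ExtL E} (hC : IsSmoothSection C) (i) :
      dWirtinger i (scaleExt t ∘ localRep x C) (extChartAt 𝓘(ℂ, E) x x) =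
        scaleExt t (dWirtinger i (localRep x C) (extChartAt 𝓘(ℂ, E) x x)) :=
    dWirtinger_linearMap_comp (scaleExt t).toLinearMap (hC.differentiableAt x)
  simp only [schouten, localRep_scaleExt, hderiv hA, hderiv hB, contractRight_scaleExt,
    contractLeft_scaleExt, Pi.smul_apply, Function.comp_apply, map_sum, map_sub, map_mul,
    smul_mul_assoc, mul_smul_comm, Finset.smul_sum, smul_sub]

theorem dbar_zero : dbar (0 : M → ExtL E) = 0 := by
  simpa using dbar_smul (0 : ℂ) (IsSmoothSection.zero (E := E) (M := M))

theorem schouten_zero_left (C : M → ExtL E) : schouten 0 C = 0 := by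
  simpa using schouten_smul_left (0 : ℂ) C IsSmoothSection.zero

theorem schouten_zero_right (C : M → ExtL E) : schouten C 0 = 0 := by
  simpa using schouten_smul_right (0 : ℂ) C IsSmoothSection.zero

end Operators

section Compatible

variable {E : Type*} [NormedAddCommGroup E] [NormedSpace ℂ E] [FiniteDimensional ℂ E]
variable {M : Type*} [TopologicalSpace M] [ChartedSpace E M] [IsManifold 𝓘(ℂ, E) 1 M]

namespace IsCompatiblePair

variable {Γ Δ : M → ExtL E} {φ ψ : M → LFibre E →L[ℂ] LFibre E}

protected theorem zero :
    IsCompatiblePair (0 : M → ExtL E) (0 : M → LFibre E →L[ℂ] LFibre E) where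
  smooth_left := .zero
  degree_two _ := zero_mem _
  smooth_right := .zero
  dbar_closed := dbar_zero
  dbar_act A _ := by
    rw [act_zero_left, act_zero_left, dbar_zero, schouten_zero_left, sub_zero]
  act_schouten A B _ _ := by
    simp only [act_zero_left, schouten_zero_left, schouten_zero_right, add_zero]
  act_wedge A B _ _ := act_mul _ A B

protected theorem add (h : IsCompatiblePair Γ φ) (k : IsCompatiblePair Δ ψ) :
    IsCompatiblePair (Γ + Δ) (φ + ψ) where
  smooth_left := h.smooth_left.add k.smooth_left
  degree_two x := add_mem (h.degree_two x) (k.degree_two x)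
  smooth_right := h.smooth_right.add k.smooth_right
  dbar_closed := by
    rw [dbar_add h.smooth_left k.smooth_left, h.dbar_closed, k.dbar_closed, add_zero]
  dbar_act A hA := by
    rw [act_add_left, act_add_left, dbar_add (hA.act h.smooth_right) (hA.act k.smooth_right),
      schouten_add_left A h.smooth_left k.smooth_left, ← h.dbar_act A hA, ← k.dbar_act A hA,
      add_sub_add_comm]
  act_schouten A B hA hB := by
    simp only [act_add_left]
    rw [schouten_add_left B (hA.act h.smooth_right) (hA.act k.smooth_right),
      schouten_add_right A (hB.act h.smooth_right) (hB.act k.smooth_right),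
      ← h.act_schouten A B hA hB, ← k.act_schouten A B hA hB, add_add_add_comm]
  act_wedge A B _ _ := act_mul _ A B

protected theorem smul (c : ℂ) (h : IsCompatiblePair Γ φ) : IsCompatiblePair (c • Γ) (c • φ) where
  smooth_left := h.smooth_left.smul c
  degree_two x := Submodule.smul_mem _ c (h.degree_two x)
  smooth_right := h.smooth_right.smul c
  dbar_closed := by rw [dbar_smul c h.smooth_left, h.dbar_closed, smul_zero]
  dbar_act A hA := by
    rw [act_smul_left, act_smul_left, dbar_smul c (hA.act h.smooth_right),
      schouten_smul_left c A h.smooth_left, ← h.dbar_act A hA, smul_sub]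
  act_schouten A B hA hB := by
    simp only [act_smul_left]
    rw [schouten_smul_left c B (hA.act h.smooth_right),
      schouten_smul_right c A (hB.act h.smooth_right), ← h.act_schouten A B hA hB, smul_add]
  act_wedge A B _ _ := act_mul _ A B

theorem scale (t : ℂˣ) (h : IsCompatiblePair Γ φ) :
    IsCompatiblePair ((t : ℂ)⁻¹ • (scaleExt t ∘ Γ)) (conjL t ∘ φ) where
  smooth_left := (h.smooth_left.scaleExt t).smul _
  degree_two x := Submodule.smul_mem _ _ (map_mem_exteriorPower _ (h.degree_two x))
  smooth_right := h.smooth_right.conjL t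
  dbar_closed := by
    rw [dbar_smul _ (h.smooth_left.scaleExt t), dbar_scaleExt t h.smooth_left, h.dbar_closed]
    funext x
    simp
  dbar_act A hA := by
    obtain ⟨B, hB, rfl⟩ := hA.exists_scaleExt_comp_eq t
    rw [act_scaleExt, dbar_scaleExt t (hB.act h.smooth_right), dbar_scaleExt t hB,
      act_scaleExt, schouten_smul_left _ _ (h.smooth_left.scaleExt t),
      schouten_scaleExt t h.smooth_left hB, inv_smul_smul₀ t.ne_zero, ← h.dbar_act B hB]
    funext x
    exact (map_sub (scaleExt t) _ _).symm
  act_schouten A B hA hB := by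
    obtain ⟨C, hC, rfl⟩ := hA.exists_scaleExt_comp_eq t
    obtain ⟨D, hD, rfl⟩ := hB.exists_scaleExt_comp_eq t
    rw [act_scaleExt, act_scaleExt, schouten_scaleExt t (hC.act h.smooth_right) hD,
      schouten_scaleExt t hC (hD.act h.smooth_right), schouten_scaleExt t hC hD, act_smul_right,
      act_scaleExt, ← h.act_schouten C D hC hD, ← smul_add]
    congr 1
    funext x
    exact (map_add (scaleExt t) _ _).symm
  act_wedge A B _ _ := act_mul _ A B

end IsCompatiblePair

/-- The complex vector space of compatible pairs `(Γ, φ)`. -/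
def compatiblePairs : Submodule ℂ ((M → ExtL E) × (M → LFibre E →L[ℂ] LFibre E)) where
  carrier := {p | IsCompatiblePair p.1 p.2}
  zero_mem' := .zero
  add_mem' := .add
  smul_mem' c _ := .smul c

theorem laurent_mem_compatiblePairs {Γ : M → ExtL E} {φ : M → LFibre E →L[ℂ] LFibre E}
    (h : IsCompatiblePair Γ φ) (t : ℂˣ) :
    (t : ℂ) • (bivectorPart Γ, block₄ φ) + (mixedPart Γ, block₁ φ + block₂ φ) +
      (t : ℂ)⁻¹ • (formPart Γ, block₃ φ) ∈ compatiblePairs := by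
  have hscale := h.scale t
  rwa [scaleExt_comp_eq_parts t h.degree_two, conjL_comp_eq_blocks] at hscale

end Compatible

end ComplexDGA

end

theorem proposition4p1
    {E : Type*} [NormedAddCommGroup E] [NormedSpace ℂ E] [FiniteDimensional ℂ E]
    {M : Type*} [TopologicalSpace M] [ChartedSpace E M] [IsManifold 𝓘(ℂ, E) 1 M]
    (Γ₁ : M → ComplexDGA.ExtL E) (φ : M → ComplexDGA.LFibre E →L[ℂ] ComplexDGA.LFibre E)
    (hΓ_smooth : ComplexDGA.IsSmoothSection Γ₁)
    (hΓ_deg : ∀ x, Γ₁ x ∈ ⋀[ℂ]^2 (ComplexDGA.LFibre E))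
    (hφ_smooth : ComplexDGA.IsSmoothEnd φ) :
    ComplexDGA.IsCompatiblePair Γ₁ φ ↔
      ComplexDGA.IsCompatiblePair (ComplexDGA.bivectorPart Γ₁) (ComplexDGA.block₄ φ) ∧
      ComplexDGA.IsCompatiblePair (ComplexDGA.formPart Γ₁) (ComplexDGA.block₃ φ) ∧
      ComplexDGA.IsCompatiblePair (ComplexDGA.mixedPart Γ₁)
        (ComplexDGA.block₁ φ + ComplexDGA.block₂ φ) := by
  constructor
  · intro h
    obtain ⟨hΛ, hΩ, hmixed⟩ := ComplexDGA.mem_of_forall_laurent_mem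
      ComplexDGA.compatiblePairs (ComplexDGA.laurent_mem_compatiblePairs h)
    exact ⟨hΛ, hΩ, hmixed⟩
  · rintro ⟨hΛ, hΩ, hmixed⟩
    have hsum := hΛ.add (hΩ.add hmixed)
    rwa [ComplexDGA.bivectorPart_add_formPart_add_mixedPart,
      ComplexDGA.block₄_add_block₃_add_block₁_add_block₂] at hsum
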